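/- Let $K$ be a field and let $E=(E^0,E^1,r,s)$ be a finite directed graph (that is, $E^0$ and $E^1$ are finite sets; loops and multiple edges are allowed). Let $L_K(E)$ be the Leavitt path algebra of $E$, that is, the associative $K$-algebra (a priori without unit) generated by pairwise orthogonal idempotents $\{v : v\in E^0\}$ together with elements $\{e,e^*: e\in E^1\}$ subject to the relations 1. $s(e)e=e=e\,r(e)$ for all $e\in E^1$; 2. $r(e)e^*=e^*=e^*s(e)$ for all $e\in E^1$; 3. $e^*e=r(e)$ for all $e\in E^1$, and $e^*f=0$ for all $e\neq f$ in $E^1$; 4. $v=\sum_{e\in E^1,\,s(e)=v}ee^*$ for every vertex $v$ that emits a non-empty finite set of edges. Since $E^0$ is finite, $L_K(E)$ is a unital ring with identity $\sum_{v\in E^0}v$, and modules are unital. Then: - every simple left $L_K(E)$-module is injective if and only if $L_K(E)$ is von Neumann regular (that is, for each $a\in L_K(E)$ there is $b\in L_K(E)$ with $a=aba$); - every simple right $L_K(E)$-module is injective if and only if $L_K(E)$ is von Neumann regular. -/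

import Mathlib

/-- A directed graph with vertex set `V`, edge set `E`, and source and range maps `s, r : E → V`
(loops and multiple edges are allowed). -/
structure DirectedGraph (V : Type*) (E : Type*) where
  s : E → V
  r : E → V

namespace LeavittPath

/-- The generators of a Leavitt path algebra: the vertices `v`, the edges `e`, and the ghost
edges `e^*`. -/
inductive Gen (V : Type*) (E : Type*) where
  | vertex : V → Gen V E
  | edge : E → Gen V E
  | ghost : E → Gen V E

/-- The free associative `K`-algebra (without unit) on the generators: the semigroup algebra of the
free semigroup of non-empty words. -/
abbrev FreeAlg (K : Type*) [Field K] (V : Type*) (E : Type*) :=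
  MonoidAlgebra K (FreeSemigroup (Gen V E))

section Generators

variable (K : Type*) [Field K] {V E : Type*}

/-- A generator, as an element of the free algebra. -/
noncomputable def FreeAlg.of (x : Gen V E) : FreeAlg K V E :=
  MonoidAlgebra.single (FreeSemigroup.of x) 1

/-- The vertex `v` in the free algebra. -/
noncomputable abbrev FreeAlg.vertex (v : V) : FreeAlg K V E := FreeAlg.of K (Gen.vertex v)

/-- The edge `e` in the free algebra. -/
noncomputable abbrev FreeAlg.edge (e : E) : FreeAlg K V E := FreeAlg.of K (Gen.edge e)

/-- The ghost edge `e^*` in the free algebra. -/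
noncomputable abbrev FreeAlg.ghost (e : E) : FreeAlg K V E := FreeAlg.of K (Gen.ghost e)

end Generators

open FreeAlg in
/-- The defining relations of the Leavitt path algebra, together with their scalar multiples
(so that the ring congruence which they generate is a congruence of `K`-algebras). -/
inductive Rel (K : Type*) [Field K] {V E : Type*} (G : DirectedGraph V E) :
    FreeAlg K V E → FreeAlg K V E → Prop
  | idem (v : V) : Rel K G (vertex K v * vertex K v) (vertex K v)
  | orth (v w : V) : v ≠ w → Rel K G (vertex K v * vertex K w) 0
  | source_edge (e : E) : Rel K G (vertex K (G.s e) * edge K e) (edge K e)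
  | edge_range (e : E) : Rel K G (edge K e * vertex K (G.r e)) (edge K e)
  | range_ghost (e : E) : Rel K G (vertex K (G.r e) * ghost K e) (ghost K e)
  | ghost_source (e : E) : Rel K G (ghost K e * vertex K (G.s e)) (ghost K e)
  | ck1_same (e : E) : Rel K G (ghost K e * edge K e) (vertex K (G.r e))
  | ck1_ne (e f : E) : e ≠ f → Rel K G (ghost K e * edge K f) 0
  | ck2 (v : V) (hfin : {e : E | G.s e = v}.Finite) (hne : {e : E | G.s e = v}.Nonempty) :
      Rel K G (vertex K v) (∑ e ∈ hfin.toFinset, edge K e * ghost K e)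
  | smul (k : K) {a b : FreeAlg K V E} : Rel K G a b → Rel K G (k • a) (k • b)

end LeavittPath

/-- The Leavitt path algebra `L_K(G)` of an arbitrary directed graph `G`: the free associative
`K`-algebra on the vertices, edges and ghost edges, modulo the defining relations. -/
def LeavittPathAlgebra (K : Type*) [Field K] {V E : Type*} (G : DirectedGraph V E) : Type _ :=
  (ringConGen (LeavittPath.Rel K G)).Quotient

namespace LeavittPathAlgebra

open LeavittPath

section

variable (K : Type*) [Field K] {V E : Type*} (G : DirectedGraph V E)

noncomputable instance instNonUnitalRing : NonUnitalRing (LeavittPathAlgebra K G) :=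
  inferInstanceAs (NonUnitalRing (ringConGen (LeavittPath.Rel K G)).Quotient)

/-- The quotient map from the free algebra. -/
noncomputable def mk : FreeAlg K V E →ₙ+* LeavittPathAlgebra K G where
  toFun a := (a : (ringConGen (LeavittPath.Rel K G)).Quotient)
  map_mul' _ _ := rfl
  map_zero' := rfl
  map_add' _ _ := rfl

theorem mk_surjective : Function.Surjective (mk K G) := fun x => Quotient.exists_rep x

variable {K G} in
theorem mk_eq_of_rel {a b : FreeAlg K V E} (h : Rel K G a b) : mk K G a = mk K G b :=
  Quotient.sound (RingConGen.Rel.of _ _ h)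

theorem conGen_smul (k : K) {a b : FreeAlg K V E} (h : RingConGen.Rel (Rel K G) a b) :
    RingConGen.Rel (Rel K G) (k • a) (k • b) := by
  induction h with
  | of _ _ h => exact .of _ _ (.smul k h)
  | refl _ => exact .refl _
  | symm _ ih => exact ih.symm
  | trans _ _ ih₁ ih₂ => exact ih₁.trans ih₂
  | add _ _ ih₁ ih₂ => simpa only [smul_add] using ih₁.add ih₂
  | mul _ h₂ ih₁ _ => simpa only [smul_mul_assoc] using ih₁.mul h₂

noncomputable instance instSMul : SMul K (LeavittPathAlgebra K G) where
  smul k := Quotient.map' (k • ·) (fun _ _ h => conGen_smul K G k h)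

theorem mk_smul (k : K) (a : FreeAlg K V E) : mk K G (k • a) = k • mk K G a := rfl

noncomputable instance instModule : Module K (LeavittPathAlgebra K G) :=
  (mk_surjective K G).module K (mk K G).toAddMonoidHom (mk_smul K G)

instance instIsScalarTower :
    IsScalarTower K (LeavittPathAlgebra K G) (LeavittPathAlgebra K G) where
  smul_assoc k x y := by
    obtain ⟨a, rfl⟩ := mk_surjective K G x
    obtain ⟨b, rfl⟩ := mk_surjective K G y
    simp only [smul_eq_mul, ← mk_smul, ← map_mul, smul_mul_assoc]

instance instSMulCommClass :
    SMulCommClass K (LeavittPathAlgebra K G) (LeavittPathAlgebra K G) where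
  smul_comm k x y := by
    obtain ⟨a, rfl⟩ := mk_surjective K G x
    obtain ⟨b, rfl⟩ := mk_surjective K G y
    simp only [smul_eq_mul, ← mk_smul, ← map_mul, mul_smul_comm]

/-- The vertex `v` as an element of `L_K(G)`. -/
noncomputable def vertex (v : V) : LeavittPathAlgebra K G := mk K G (FreeAlg.vertex K v)

/-- Two linear endomorphisms of `L_K(G)` agree if they agree on the classes of words. -/
theorem linearMap_ext {f g : LeavittPathAlgebra K G →ₗ[K] LeavittPathAlgebra K G}
    (h : ∀ w : FreeSemigroup (Gen V E),
      f (mk K G (MonoidAlgebra.single w 1)) = g (mk K G (MonoidAlgebra.single w 1))) : f = g := by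
  ext x
  obtain ⟨a, rfl⟩ := mk_surjective K G x
  induction a using MonoidAlgebra.induction_linear with
  | zero => simp
  | add a b ha hb => simp only [map_add, ha, hb]
  | single w k =>
    have : (MonoidAlgebra.single w k : FreeAlg K V E) = k • MonoidAlgebra.single w 1 := by simp
    rw [this, mk_smul, map_smul, map_smul, h]

theorem exists_vertex_mul (x : Gen V E) :
    ∃ v, vertex K G v * mk K G (FreeAlg.of K x) = mk K G (FreeAlg.of K x) := by
  cases x with
  | vertex v => exact ⟨v, by rw [vertex, ← map_mul]; exact mk_eq_of_rel (.idem v)⟩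
  | edge e => exact ⟨G.s e, by rw [vertex, ← map_mul]; exact mk_eq_of_rel (.source_edge e)⟩
  | ghost e => exact ⟨G.r e, by rw [vertex, ← map_mul]; exact mk_eq_of_rel (.range_ghost e)⟩

theorem exists_mul_vertex (x : Gen V E) :
    ∃ v, mk K G (FreeAlg.of K x) * vertex K G v = mk K G (FreeAlg.of K x) := by
  cases x with
  | vertex v => exact ⟨v, by rw [vertex, ← map_mul]; exact mk_eq_of_rel (.idem v)⟩
  | edge e => exact ⟨G.r e, by rw [vertex, ← map_mul]; exact mk_eq_of_rel (.edge_range e)⟩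
  | ghost e => exact ⟨G.s e, by rw [vertex, ← map_mul]; exact mk_eq_of_rel (.ghost_source e)⟩

theorem vertex_mul_self (v : V) : vertex K G v * vertex K G v = vertex K G v := by
  rw [vertex, ← map_mul]; exact mk_eq_of_rel (.idem v)

theorem vertex_mul_of_ne {v w : V} (h : v ≠ w) : vertex K G v * vertex K G w = 0 := by
  rw [vertex, vertex, ← map_mul, mk_eq_of_rel (.orth v w h), map_zero]

theorem mk_single_mul (w w' : FreeSemigroup (Gen V E)) :
    mk K G (MonoidAlgebra.single (w * w') 1) =
      mk K G (MonoidAlgebra.single w 1) * mk K G (MonoidAlgebra.single w' 1) := by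
  rw [← map_mul, MonoidAlgebra.single_mul_single, one_mul]

variable [Finite V]

/-- If the graph has finitely many vertices, `L_K(G)` has an identity element, namely the sum of
all vertices. -/
noncomputable instance instOne : One (LeavittPathAlgebra K G) := ⟨∑ᶠ v : V, vertex K G v⟩

theorem one_mul_vertex (v : V) : 1 * vertex K G v = vertex K G v := by
  have := Fintype.ofFinite V
  change (∑ᶠ w : V, vertex K G w) * vertex K G v = vertex K G v
  rw [finsum_eq_sum_of_fintype, Finset.sum_mul,
    Finset.sum_eq_single v (fun w _ h => vertex_mul_of_ne K G h) (by simp), vertex_mul_self]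

theorem vertex_mul_one (v : V) : vertex K G v * 1 = vertex K G v := by
  have := Fintype.ofFinite V
  change vertex K G v * (∑ᶠ w : V, vertex K G w) = vertex K G v
  rw [finsum_eq_sum_of_fintype, Finset.mul_sum,
    Finset.sum_eq_single v (fun w _ h => vertex_mul_of_ne K G h.symm) (by simp), vertex_mul_self]

protected theorem one_mul' (x : LeavittPathAlgebra K G) : 1 * x = x := by
  have h : LinearMap.mulLeft K (1 : LeavittPathAlgebra K G) = LinearMap.id := by
    refine linearMap_ext K G fun w => ?_
    rw [LinearMap.mulLeft_apply, LinearMap.id_apply]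
    induction w using FreeSemigroup.recOnMul with
    | ih1 x =>
      obtain ⟨v, hv⟩ := exists_vertex_mul K G x
      change 1 * mk K G (FreeAlg.of K x) = mk K G (FreeAlg.of K x)
      rw [← hv, ← mul_assoc, one_mul_vertex]
    | ih2 x w hx _ => rw [mk_single_mul, ← mul_assoc, hx]
  exact LinearMap.congr_fun h x

protected theorem mul_one' (x : LeavittPathAlgebra K G) : x * 1 = x := by
  have h : LinearMap.mulRight K (1 : LeavittPathAlgebra K G) = LinearMap.id := by
    refine linearMap_ext K G fun w => ?_
    rw [LinearMap.mulRight_apply, LinearMap.id_apply]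
    induction w using FreeSemigroup.recOnMul with
    | ih1 x =>
      obtain ⟨v, hv⟩ := exists_mul_vertex K G x
      change mk K G (FreeAlg.of K x) * 1 = mk K G (FreeAlg.of K x)
      rw [← hv, mul_assoc, vertex_mul_one]
    | ih2 x w _ hw => rw [mk_single_mul, mul_assoc, hw]
  exact LinearMap.congr_fun h x

noncomputable instance instRing : Ring (LeavittPathAlgebra K G) where
  __ := instNonUnitalRing K G
  one := 1
  one_mul := LeavittPathAlgebra.one_mul' K G
  mul_one := LeavittPathAlgebra.mul_one' K G

end

end LeavittPathAlgebra

/-- A ring `R` is von Neumann regular if for each `a` there is `b` with `a = a b a`. -/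
def IsVonNeumannRegular (R : Type*) [NonUnitalRing R] : Prop :=
  ∀ a : R, ∃ b : R, a = a * b * a

universe uK uV uE w

/-!
Let `L = L_K(G)`. Each of the conditions in the theorem is equivalent to `G` being acyclic.

If `G` is acyclic, `L` is a semisimple ring (`isSemisimpleRing_of_isAcyclic`), so that all its
left and right modules are injective, and it is von Neumann regular. Indeed every vertex lies in the
left socle of `L`, by induction along the edges: a sink generates a simple left ideal, and for any
other vertex `v = ∑ e e^*`, where `e^* = r(e) e^*` lies in the socle because the socle is stable
under right multiplication.

If `G` is not acyclic, it has a periodic infinite path `x₀ = c c c ⋯` (`BranchingSystem` abstracts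
the combinatorics of infinite paths). The space `S` with basis the infinite paths having a common
tail with `x₀` is a simple `L`-module, on which an edge acts by being prepended. The same paths with
coefficients in the dual numbers `K[ε]` carry a deformation `M` of this representation, in which an
edge that completes a path to `x₀` is multiplied by `1 + ε`; it contains a copy `ε M` of `S`.
Take `c` to be a minimal period and let `a = c - 1`. Then `a x₀ = ε x₀` in `M`, whereas `x₀ ∉ a S`,
since the coefficient at `x₀` of `a y` vanishes for all `y ∈ S`. Both properties fail:

* if `S` is injective, there is a retraction `f : M → S` of the inclusion `S ≅ ε M ⊆ M`, and
  `a f(x₀) = f(ε x₀) = x₀` in `S` (`exists_isSimpleModule_not_injective`);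
* if `a = a b a`, then `ε x₀ = a b (ε x₀)` in `M`, that is, `x₀ = a (b x₀)` in `S`
  (`not_isVonNeumannRegular`).

For right modules, `S` is regarded as a module over the opposite ring by means of the involution
of `L` which exchanges `e` and `e^*`.
-/

/-! ### Generators and the universal property -/

namespace LeavittPathAlgebra

open LeavittPath

section

variable (K : Type*) [Field K] {V E : Type*} (G : DirectedGraph V E)

/-- The edge `e` as an element of `L_K(G)`. -/
noncomputable def edge (e : E) : LeavittPathAlgebra K G := mk K G (FreeAlg.edge K e)

/-- The ghost edge `e^*` as an element of `L_K(G)`. -/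
noncomputable def ghost (e : E) : LeavittPathAlgebra K G := mk K G (FreeAlg.ghost K e)

theorem vertex_source_mul_edge (e : E) : vertex K G (G.s e) * edge K G e = edge K G e := by
  rw [vertex, edge, ← map_mul]; exact mk_eq_of_rel (.source_edge e)

theorem edge_mul_vertex_range (e : E) : edge K G e * vertex K G (G.r e) = edge K G e := by
  rw [vertex, edge, ← map_mul]; exact mk_eq_of_rel (.edge_range e)

theorem vertex_range_mul_ghost (e : E) : vertex K G (G.r e) * ghost K G e = ghost K G e := by
  rw [vertex, ghost, ← map_mul]; exact mk_eq_of_rel (.range_ghost e)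

theorem ghost_mul_vertex_source (e : E) : ghost K G e * vertex K G (G.s e) = ghost K G e := by
  rw [vertex, ghost, ← map_mul]; exact mk_eq_of_rel (.ghost_source e)

theorem ghost_mul_edge_self (e : E) : ghost K G e * edge K G e = vertex K G (G.r e) := by
  rw [vertex, ghost, edge, ← map_mul]; exact mk_eq_of_rel (.ck1_same e)

theorem ghost_mul_edge_of_ne {e f : E} (h : e ≠ f) : ghost K G e * edge K G f = 0 := by
  rw [ghost, edge, ← map_mul, mk_eq_of_rel (.ck1_ne e f h), map_zero]

theorem vertex_eq_sum (v : V) (hfin : {e : E | G.s e = v}.Finite)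
    (hne : {e : E | G.s e = v}.Nonempty) :
    vertex K G v = ∑ e ∈ hfin.toFinset, edge K G e * ghost K G e := by
  rw [vertex, mk_eq_of_rel (.ck2 v hfin hne), map_sum]
  simp only [map_mul, edge, ghost]

theorem vertex_mul_edge_of_ne {v : V} {e : E} (h : v ≠ G.s e) :
    vertex K G v * edge K G e = 0 := by
  rw [← vertex_source_mul_edge, ← mul_assoc, vertex_mul_of_ne K G h, zero_mul]

theorem ghost_mul_vertex_of_ne {v : V} {e : E} (h : G.s e ≠ v) :
    ghost K G e * vertex K G v = 0 := by
  rw [← ghost_mul_vertex_source, mul_assoc, vertex_mul_of_ne K G h, mul_zero]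

/-- The class of a generator in `L_K(G)`. -/
noncomputable def gen : Gen V E → LeavittPathAlgebra K G
  | .vertex v => vertex K G v
  | .edge e => edge K G e
  | .ghost e => ghost K G e

theorem mk_of (x : Gen V E) : mk K G (FreeAlg.of K x) = gen K G x := by
  cases x <;> rfl

variable [Finite V]

noncomputable instance instAlgebra : Algebra K (LeavittPathAlgebra K G) :=
  Algebra.ofModule smul_mul_assoc mul_smul_comm

theorem one_eq_finsum : (1 : LeavittPathAlgebra K G) = ∑ᶠ v, vertex K G v := rfl

theorem adjoin_range_gen : Algebra.adjoin K (Set.range (gen K G)) = ⊤ := by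
  refine eq_top_iff.2 fun x hx => ?_
  clear hx
  obtain ⟨a, rfl⟩ := mk_surjective K G x
  induction a using MonoidAlgebra.induction_linear with
  | zero => rw [map_zero]; exact zero_mem _
  | add a b ha hb => rw [map_add]; exact add_mem ha hb
  | single w k =>
    have : (MonoidAlgebra.single w k : FreeAlg K V E) = k • MonoidAlgebra.single w 1 := by simp
    rw [this, mk_smul]
    clear this
    refine Subalgebra.smul_mem _ ?_ k
    induction w using FreeSemigroup.recOnMul with
    | ih1 x => exact Algebra.subset_adjoin ⟨x, (mk_of K G x).symm⟩
    | ih2 x w hx hw => rw [mk_single_mul]; exact mul_mem hx hw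

variable {K G}

theorem algHom_ext {A : Type*} [Semiring A] [Algebra K A] {f g : LeavittPathAlgebra K G →ₐ[K] A}
    (hv : ∀ v, f (vertex K G v) = g (vertex K G v)) (he : ∀ e, f (edge K G e) = g (edge K G e))
    (hg : ∀ e, f (ghost K G e) = g (ghost K G e)) : f = g := by
  refine AlgHom.ext_of_adjoin_eq_top (adjoin_range_gen K G) ?_
  rintro _ ⟨x, rfl⟩
  cases x with
  | vertex v => exact hv v
  | edge e => exact he e
  | ghost e => exact hg e

@[elab_as_elim]
theorem gen_induction {P : LeavittPathAlgebra K G → Prop} (vertex : ∀ v, P (vertex K G v))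
    (edge : ∀ e, P (edge K G e)) (ghost : ∀ e, P (ghost K G e))
    (algebraMap : ∀ k : K, P (algebraMap K _ k)) (add : ∀ a b, P a → P b → P (a + b))
    (mul : ∀ a b, P a → P b → P (a * b)) (a : LeavittPathAlgebra K G) : P a := by
  have ha : a ∈ Algebra.adjoin K (Set.range (gen K G)) := adjoin_range_gen K G ▸ trivial
  induction ha using Algebra.adjoin_induction with
  | mem _ hx =>
    obtain ⟨x, rfl⟩ := hx
    cases x with
    | vertex v => exact vertex v
    | edge e => exact edge e
    | ghost e => exact ghost e
  | algebraMap k => exact algebraMap k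
  | add a b _ _ iha ihb => exact add a b iha ihb
  | mul a b _ _ iha ihb => exact mul a b iha ihb

end

/-- A family of elements of a ring `A`, indexed by the vertices, edges and ghost edges of `G`,
satisfying the defining relations of `L_K(G)` and whose vertices add up to `1`. -/
structure Family {V E : Type*} (G : DirectedGraph V E) (A : Type*) [Ring A] where
  vertex : V → A
  edge : E → A
  ghost : E → A
  idem (v : V) : vertex v * vertex v = vertex v
  orth (v w : V) : v ≠ w → vertex v * vertex w = 0
  source_edge (e : E) : vertex (G.s e) * edge e = edge e
  edge_range (e : E) : edge e * vertex (G.r e) = edge e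
  range_ghost (e : E) : vertex (G.r e) * ghost e = ghost e
  ghost_source (e : E) : ghost e * vertex (G.s e) = ghost e
  ck1_same (e : E) : ghost e * edge e = vertex (G.r e)
  ck1_ne (e f : E) : e ≠ f → ghost e * edge f = 0
  ck2 (v : V) (hfin : {e : E | G.s e = v}.Finite) (hne : {e : E | G.s e = v}.Nonempty) :
    vertex v = ∑ e ∈ hfin.toFinset, edge e * ghost e
  finsum_vertex : ∑ᶠ v, vertex v = 1

namespace Family

variable {K : Type*} [Field K] {V E : Type*} {G : DirectedGraph V E} {A : Type*} [Ring A]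
  [Algebra K A] (F : Family G A)

/-- The value of the family at a generator. -/
def gen : Gen V E → A
  | .vertex v => F.vertex v
  | .edge e => F.edge e
  | .ghost e => F.ghost e

variable (K)

/-- The homomorphism from the free algebra determined by a family. -/
noncomputable def freeLift : FreeAlg K V E →ₙₐ[K] A :=
  MonoidAlgebra.liftMagma K (FreeSemigroup.lift F.gen)

theorem freeLift_of (x : Gen V E) : F.freeLift K (FreeAlg.of K x) = F.gen x := by
  simp [freeLift, FreeAlg.of]

theorem freeLift_eq_of_rel {a b : FreeAlg K V E} (h : Rel K G a b) :
    F.freeLift K a = F.freeLift K b := by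
  induction h with
  | idem v => simp only [map_mul, freeLift_of]; exact F.idem v
  | orth v w h => simp only [map_mul, freeLift_of, map_zero]; exact F.orth v w h
  | source_edge e => simp only [map_mul, freeLift_of]; exact F.source_edge e
  | edge_range e => simp only [map_mul, freeLift_of]; exact F.edge_range e
  | range_ghost e => simp only [map_mul, freeLift_of]; exact F.range_ghost e
  | ghost_source e => simp only [map_mul, freeLift_of]; exact F.ghost_source e
  | ck1_same e => simp only [map_mul, freeLift_of]; exact F.ck1_same e
  | ck1_ne e f h => simp only [map_mul, freeLift_of, map_zero]; exact F.ck1_ne e f h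
  | ck2 v hfin hne => simp only [map_mul, map_sum, freeLift_of]; exact F.ck2 v hfin hne
  | smul k _ ih => rw [map_smul, map_smul, ih]

theorem freeLift_eq_of_conGen {a b : FreeAlg K V E} (h : RingConGen.Rel (Rel K G) a b) :
    F.freeLift K a = F.freeLift K b := by
  induction h with
  | of _ _ h => exact F.freeLift_eq_of_rel K h
  | refl _ => rfl
  | symm _ ih => exact ih.symm
  | trans _ _ ih₁ ih₂ => exact ih₁.trans ih₂
  | add _ _ ih₁ ih₂ => rw [map_add, map_add, ih₁, ih₂]
  | mul _ _ ih₁ ih₂ => rw [map_mul, map_mul, ih₁, ih₂]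

/-- The function on `L_K(G)` determined by a family. -/
noncomputable def liftFun : LeavittPathAlgebra K G → A :=
  Quotient.lift (F.freeLift K) fun _ _ h => F.freeLift_eq_of_conGen K h

theorem liftFun_mk (a : FreeAlg K V E) :
    F.liftFun K (LeavittPathAlgebra.mk K G a) = F.freeLift K a := rfl

variable [Finite V]

/-- The universal property of `L_K(G)`: a family induces an algebra homomorphism. -/
noncomputable def lift : LeavittPathAlgebra K G →ₐ[K] A :=
  AlgHom.ofLinearMap
    { toFun := F.liftFun K
      map_add' := fun x y => by
        obtain ⟨a, rfl⟩ := mk_surjective K G x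
        obtain ⟨b, rfl⟩ := mk_surjective K G y
        rw [← map_add (LeavittPathAlgebra.mk K G), liftFun_mk, liftFun_mk, liftFun_mk, map_add]
      map_smul' := fun k x => by
        obtain ⟨a, rfl⟩ := mk_surjective K G x
        rw [← mk_smul]; simp only [liftFun_mk, map_smul, RingHom.id_apply] }
    (by
      have := Fintype.ofFinite V
      change F.liftFun K 1 = 1
      rw [one_eq_finsum, ← F.finsum_vertex, finsum_eq_sum_of_fintype, finsum_eq_sum_of_fintype]
      simp only [LeavittPathAlgebra.vertex]
      rw [← map_sum, liftFun_mk, map_sum]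
      simp only [freeLift_of]
      rfl)
    (fun x y => by
      obtain ⟨a, rfl⟩ := mk_surjective K G x
      obtain ⟨b, rfl⟩ := mk_surjective K G y
      rw [← map_mul]
      exact map_mul (F.freeLift K) a b)

@[simp] theorem lift_vertex (v : V) : F.lift K (LeavittPathAlgebra.vertex K G v) = F.vertex v :=
  F.freeLift_of K (.vertex v)

@[simp] theorem lift_edge (e : E) : F.lift K (LeavittPathAlgebra.edge K G e) = F.edge e :=
  F.freeLift_of K (.edge e)

@[simp] theorem lift_ghost (e : E) : F.lift K (LeavittPathAlgebra.ghost K G e) = F.ghost e :=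
  F.freeLift_of K (.ghost e)

end Family

section Involution

variable (K : Type*) [Field K] {V E : Type*} (G : DirectedGraph V E) [Finite V]

open MulOpposite

/-- The generators of `L_K(G)` in the opposite algebra, with edges and ghost edges exchanged. -/
noncomputable def opFamily : Family G (LeavittPathAlgebra K G)ᵐᵒᵖ where
  vertex v := op (vertex K G v)
  edge e := op (ghost K G e)
  ghost e := op (edge K G e)
  idem v := by rw [← op_mul, vertex_mul_self]
  orth v w h := by rw [← op_mul, vertex_mul_of_ne K G h.symm, op_zero]
  source_edge e := by rw [← op_mul, ghost_mul_vertex_source]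
  edge_range e := by rw [← op_mul, vertex_range_mul_ghost]
  range_ghost e := by rw [← op_mul, edge_mul_vertex_range]
  ghost_source e := by rw [← op_mul, vertex_source_mul_edge]
  ck1_same e := by rw [← op_mul, ghost_mul_edge_self]
  ck1_ne e f h := by rw [← op_mul, ghost_mul_edge_of_ne K G h.symm, op_zero]
  ck2 v hfin hne := by
    rw [vertex_eq_sum K G v hfin hne, Finset.op_sum]
    simp only [op_mul]
  finsum_vertex := by
    have := Fintype.ofFinite V
    rw [← op_one, one_eq_finsum, finsum_eq_sum_of_fintype, finsum_eq_sum_of_fintype, Finset.op_sum]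

/-- The involution of `L_K(G)` fixing the vertices and exchanging `e` and `e^*`, as a homomorphism
from the opposite algebra. -/
noncomputable def involution : (LeavittPathAlgebra K G)ᵐᵒᵖ →ₐ[K] LeavittPathAlgebra K G :=
  AlgHom.opComm ((opFamily K G).lift K)

theorem involution_surjective : Function.Surjective (involution K G) := by
  have h : (involution K G).comp ((opFamily K G).lift K) = AlgHom.id K _ := by
    apply algHom_ext <;> intro x <;> simp [involution, opFamily]
  exact fun x => ⟨_, DFunLike.congr_fun h x⟩

end Involution

end LeavittPathAlgebra

/-! ### Branching systems and their representations -/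

/-- A branching system of a directed graph: a set of "infinite paths" `x`, each with a first edge
`head x` and a remaining path `tail x`, such that every `x` can be uniquely extended by each edge
whose range is the source of `x`. -/
structure BranchingSystem {V E : Type*} (G : DirectedGraph V E) (X : Type*) where
  head : X → E
  tail : X → X
  cons (e : E) (x : X) (h : G.r e = G.s (head x)) : X
  range_head (x : X) : G.r (head x) = G.s (head (tail x))
  head_cons (e : E) (x : X) (h : G.r e = G.s (head x)) : head (cons e x h) = e
  tail_cons (e : E) (x : X) (h : G.r e = G.s (head x)) : tail (cons e x h) = x
  ext (x y : X) (h : head x = head y) (h' : tail x = tail y) : x = y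

namespace BranchingSystem

open Classical LeavittPathAlgebra

variable {K : Type*} [Field K] {V E : Type*} {G : DirectedGraph V E} {X : Type*}
  (B : BranchingSystem G X)

theorem cons_head_tail (x : X) : B.cons (B.head x) (B.tail x) (B.range_head x) = x :=
  B.ext _ _ (B.head_cons _ _ _) (B.tail_cons _ _ _)

theorem exists_head_tail {e : E} {x : X} (h : G.r e = G.s (B.head x)) :
    ∃ y, B.head y = e ∧ B.tail y = x :=
  ⟨B.cons e x h, B.head_cons _ _ _, B.tail_cons _ _ _⟩

variable (K) {A : Type*} [CommRing A] [Algebra K A] (w : X → Aˣ)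

/-- The action of a vertex: the projection onto the paths starting there. -/
noncomputable def vertexOp (v : V) : Module.End K (X →₀ A) :=
  Finsupp.lsum K fun x => if G.s (B.head x) = v then Finsupp.lsingle x else 0

/-- The action of an edge: it is prepended to a path `x`, and the coefficient is multiplied by the
weight of the resulting path. -/
noncomputable def edgeOp (e : E) : Module.End K (X →₀ A) :=
  Finsupp.lsum K fun x =>
    if h : G.r e = G.s (B.head x) then
      Finsupp.lsingle (B.cons e x h) ∘ₗ LinearMap.mulLeft K (w (B.cons e x h) : A)
    else 0

/-- The action of a ghost edge: the first edge of a path `x` is removed, and the coefficient is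
divided by the weight of `x`. -/
noncomputable def ghostOp (e : E) : Module.End K (X →₀ A) :=
  Finsupp.lsum K fun x =>
    if B.head x = e then
      Finsupp.lsingle (B.tail x) ∘ₗ LinearMap.mulLeft K (↑(w x)⁻¹ : A)
    else 0

theorem vertexOp_single (v : V) (x : X) (a : A) :
    B.vertexOp K v (Finsupp.single x a) =
      if G.s (B.head x) = v then Finsupp.single x a else 0 := by
  rw [vertexOp, Finsupp.lsum_single]
  split_ifs <;> simp

theorem edgeOp_single_tail (x : X) (a : A) :
    B.edgeOp K w (B.head x) (Finsupp.single (B.tail x) a) = Finsupp.single x (w x * a) := by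
  rw [edgeOp, Finsupp.lsum_single, dif_pos (B.range_head x)]
  simp [B.cons_head_tail x]

theorem edgeOp_single_of_ne {e : E} {x : X} (h : G.r e ≠ G.s (B.head x)) (a : A) :
    B.edgeOp K w e (Finsupp.single x a) = 0 := by
  rw [edgeOp, Finsupp.lsum_single, dif_neg h, LinearMap.zero_apply]

theorem ghostOp_single_head (x : X) (a : A) :
    B.ghostOp K w (B.head x) (Finsupp.single x a) =
      Finsupp.single (B.tail x) (↑(w x)⁻¹ * a) := by
  simp [ghostOp, Finsupp.lsum_single]

theorem ghostOp_single_of_ne {e : E} {x : X} (h : B.head x ≠ e) (a : A) :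
    B.ghostOp K w e (Finsupp.single x a) = 0 := by
  rw [ghostOp, Finsupp.lsum_single, if_neg h, LinearMap.zero_apply]

theorem edgeOp_ghostOp_single (e : E) (x : X) (a : A) :
    B.edgeOp K w e (B.ghostOp K w e (Finsupp.single x a)) =
      if B.head x = e then Finsupp.single x a else 0 := by
  split_ifs with h
  · subst h
    rw [ghostOp_single_head, edgeOp_single_tail, Units.mul_inv_cancel_left]
  · rw [ghostOp_single_of_ne K B w h, map_zero]

variable {K} in
theorem edgeOp_head_apply (x : X) (y : X →₀ A) :
    B.edgeOp K w (B.head x) y x = w x * y (B.tail x) := by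
  have h : Finsupp.lapply x ∘ₗ B.edgeOp K w (B.head x) =
      LinearMap.mulLeft K (w x : A) ∘ₗ Finsupp.lapply (B.tail x) := by
    refine Finsupp.lhom_ext fun z a => ?_
    by_cases hz : G.r (B.head x) = G.s (B.head z)
    · obtain ⟨z, hh, rfl⟩ := B.exists_head_tail hz
      rw [← hh]
      by_cases hzx : z = x
      · subst hzx
        simp [edgeOp_single_tail]
      · have : B.tail z ≠ B.tail x := fun h => hzx (B.ext _ _ hh h)
        simp [edgeOp_single_tail, hzx, this]
    · have : z ≠ B.tail x := by
        rintro rfl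
        exact hz (B.range_head x)
      simp [edgeOp_single_of_ne K B w hz, this]
  exact DFunLike.congr_fun h y

/-- The operators of a weighted branching system satisfy the defining relations. -/
noncomputable def family [Finite V] : Family G (Module.End K (X →₀ A)) where
  vertex := B.vertexOp K
  edge := B.edgeOp K w
  ghost := B.ghostOp K w
  idem v := by
    refine Finsupp.lhom_ext fun x a => ?_
    by_cases h : G.s (B.head x) = v <;> simp [vertexOp_single, h]
  orth v v' hv := by
    refine Finsupp.lhom_ext fun x a => ?_
    by_cases h : G.s (B.head x) = v'
    · simp [vertexOp_single, h, hv.symm]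
    · simp [vertexOp_single, h]
  source_edge e := by
    refine Finsupp.lhom_ext fun x a => ?_
    by_cases h : G.r e = G.s (B.head x)
    · obtain ⟨y, rfl, rfl⟩ := B.exists_head_tail h
      simp [vertexOp_single, edgeOp_single_tail, -Finsupp.single_mul]
    · simp [edgeOp_single_of_ne K B w h]
  edge_range e := by
    refine Finsupp.lhom_ext fun x a => ?_
    by_cases h : G.r e = G.s (B.head x)
    · simp [vertexOp_single, h]
    · simp [vertexOp_single, edgeOp_single_of_ne K B w h, Ne.symm h]
  range_ghost e := by
    refine Finsupp.lhom_ext fun x a => ?_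
    by_cases h : B.head x = e
    · subst h
      simp [vertexOp_single, ghostOp_single_head, B.range_head, -Finsupp.single_mul]
    · simp [ghostOp_single_of_ne K B w h]
  ghost_source e := by
    refine Finsupp.lhom_ext fun x a => ?_
    by_cases h : B.head x = e
    · simp [vertexOp_single, h]
    · by_cases h' : G.s (B.head x) = G.s e <;>
        simp [vertexOp_single, h', ghostOp_single_of_ne K B w h]
  ck1_same e := by
    refine Finsupp.lhom_ext fun x a => ?_
    by_cases h : G.r e = G.s (B.head x)
    · obtain ⟨y, rfl, rfl⟩ := B.exists_head_tail h
      simp [vertexOp_single, edgeOp_single_tail, ghostOp_single_head, h, -Finsupp.single_mul]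
    · simp [vertexOp_single, edgeOp_single_of_ne K B w h, Ne.symm h]
  ck1_ne e f hef := by
    refine Finsupp.lhom_ext fun x a => ?_
    by_cases h : G.r f = G.s (B.head x)
    · obtain ⟨y, rfl, rfl⟩ := B.exists_head_tail h
      simp [edgeOp_single_tail, ghostOp_single_of_ne K B w hef.symm, -Finsupp.single_mul]
    · simp [edgeOp_single_of_ne K B w h]
  ck2 v hfin hne := by
    refine Finsupp.lhom_ext fun x a => ?_
    simp [vertexOp_single, edgeOp_ghostOp_single]
  finsum_vertex := by
    have := Fintype.ofFinite V
    rw [finsum_eq_sum_of_fintype]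
    refine Finsupp.lhom_ext fun x a => ?_
    simp [vertexOp_single]

variable [Finite V]

/-- The representation of `L_K(G)` on the finitely supported functions on a weighted branching
system. -/
noncomputable def rep : LeavittPathAlgebra K G →ₐ[K] Module.End K (X →₀ A) := (B.family K w).lift K

@[simp] theorem rep_vertex (v : V) : B.rep K w (vertex K G v) = B.vertexOp K v :=
  (B.family K w).lift_vertex K v

@[simp] theorem rep_edge (e : E) : B.rep K w (edge K G e) = B.edgeOp K w e :=
  (B.family K w).lift_edge K e

@[simp] theorem rep_ghost (e : E) : B.rep K w (ghost K G e) = B.ghostOp K w e :=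
  (B.family K w).lift_ghost K e

variable {K} in
/-- A linear map of coefficients compatible with the weights induces a homomorphism of
representations. -/
theorem rep_mapRange {A' : Type*} [CommRing A'] [Algebra K A'] {w' : X → A'ˣ} {j : A →ₗ[K] A'}
    (hj : ∀ x a, j (w x * a) = w' x * j a) (b : LeavittPathAlgebra K G) (y : X →₀ A) :
    B.rep K w' b (Finsupp.mapRange.linearMap j y) =
      Finsupp.mapRange.linearMap j (B.rep K w b y) := by
  have hj' (x : X) (a : A) : j (↑(w x)⁻¹ * a) = ↑(w' x)⁻¹ * j a := by
    rw [Units.eq_inv_mul_iff_mul_eq, ← hj, Units.mul_inv_cancel_left]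
  -- Two operators are intertwined if they are so on the multiples of basis vectors.
  have key {T : Module.End K (X →₀ A)} {T' : Module.End K (X →₀ A')}
      (h : ∀ x a, T' (Finsupp.mapRange.linearMap j (Finsupp.single x a)) =
        Finsupp.mapRange.linearMap j (T (Finsupp.single x a))) (y : X →₀ A) :
      T' (Finsupp.mapRange.linearMap j y) = Finsupp.mapRange.linearMap j (T y) :=
    DFunLike.congr_fun (Finsupp.lhom_ext h :
      T' ∘ₗ Finsupp.mapRange.linearMap j = Finsupp.mapRange.linearMap j ∘ₗ T) y
  induction b using gen_induction generalizing y with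
  | vertex v =>
    simp only [rep_vertex]
    refine key (fun x a => ?_) y
    by_cases h : G.s (B.head x) = v <;> simp [vertexOp_single, h]
  | edge e =>
    simp only [rep_edge]
    refine key (fun x a => ?_) y
    by_cases h : G.r e = G.s (B.head x)
    · obtain ⟨y, rfl, rfl⟩ := B.exists_head_tail h
      simp [edgeOp_single_tail, hj, -Finsupp.single_mul]
    · simp [edgeOp_single_of_ne K B _ h]
  | ghost e =>
    simp only [rep_ghost]
    refine key (fun x a => ?_) y
    by_cases h : B.head x = e
    · subst h
      simp [ghostOp_single_head, hj', -Finsupp.single_mul]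
    · simp [ghostOp_single_of_ne K B _ h]
  | algebraMap k => simp [Algebra.algebraMap_eq_smul_one]
  | add a b iha ihb =>
    rw [map_add, map_add, LinearMap.add_apply, LinearMap.add_apply, iha, ihb, map_add]
  | mul a b iha ihb =>
    rw [map_mul, map_mul, Module.End.mul_apply, Module.End.mul_apply, ihb, iha]

/-- The path `e₀ ⋯ eₙ₋₁` consisting of the first `n` edges of `x`, as an element of `L_K(G)`. -/
noncomputable def edgePrefix (x : X) : ℕ → LeavittPathAlgebra K G
  | 0 => 1
  | n + 1 => edgePrefix x n * edge K G (B.head (B.tail^[n] x))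

/-- The ghost path `eₙ₋₁^* ⋯ e₀^*` of the first `n` edges of `x`, as an element of `L_K(G)`. -/
noncomputable def ghostPrefix (x : X) : ℕ → LeavittPathAlgebra K G
  | 0 => 1
  | n + 1 => ghost K G (B.head (B.tail^[n] x)) * ghostPrefix x n

theorem rep_edgePrefix_single (x : X) (n : ℕ) (a : A) :
    B.rep K w (B.edgePrefix K x n) (Finsupp.single (B.tail^[n] x) a) =
      Finsupp.single x ((∏ i ∈ Finset.range n, (w (B.tail^[i] x) : A)) * a) := by
  induction n generalizing a with
  | zero => simp [edgePrefix]
  | succ n ih =>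
    rw [edgePrefix, map_mul, Module.End.mul_apply, rep_edge, Function.iterate_succ_apply',
      edgeOp_single_tail, ih, Finset.prod_range_succ, mul_assoc]

theorem rep_edgePrefix_apply (x : X) (n : ℕ) (y : X →₀ A) :
    B.rep K w (B.edgePrefix K x n) y x =
      (∏ i ∈ Finset.range n, (w (B.tail^[i] x) : A)) * y (B.tail^[n] x) := by
  induction n generalizing y with
  | zero => simp [edgePrefix]
  | succ n ih =>
    rw [edgePrefix, map_mul, Module.End.mul_apply, rep_edge, ih, edgeOp_head_apply,
      Function.iterate_succ_apply', Finset.prod_range_succ, mul_assoc]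

theorem rep_ghostPrefix_single (x z : X) (n : ℕ) (a : A) :
    B.rep K (1 : X → Aˣ) (B.ghostPrefix K x n) (Finsupp.single z a) =
      if ∀ i < n, B.head (B.tail^[i] z) = B.head (B.tail^[i] x) then
        Finsupp.single (B.tail^[n] z) a else 0 := by
  induction n with
  | zero => simp [ghostPrefix]
  | succ n ih =>
    rw [ghostPrefix, map_mul, Module.End.mul_apply, rep_ghost, ih]
    simp only [Nat.forall_lt_succ_right]
    by_cases h : ∀ i < n, B.head (B.tail^[i] z) = B.head (B.tail^[i] x)
    · rw [if_pos h]
      by_cases h' : B.head (B.tail^[n] z) = B.head (B.tail^[n] x)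
      · rw [if_pos ⟨h, h'⟩, ← h', ghostOp_single_head, Function.iterate_succ_apply']
        simp
      · rw [if_neg fun h'' => h' h''.2, ghostOp_single_of_ne K B _ h']
    · rw [if_neg h, if_neg fun h' => h h'.1, map_zero]

variable {K} in
/-- The unweighted representation is irreducible if paths are determined by their edges and any two
of them have a common tail: applying the ghost of a long prefix of `x₀` to a combination `y` of
finitely many paths keeps only the contribution of `x₀`, which can then be moved to any path. -/
theorem exists_rep_eq_single
    (hsep : ∀ x z, (∀ i, B.head (B.tail^[i] x) = B.head (B.tail^[i] z)) → x = z)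
    (hconn : ∀ x z, ∃ m n, B.tail^[m] x = B.tail^[n] z) {y : X →₀ K} (hy : y ≠ 0) (x : X) :
    ∃ b, B.rep K (1 : X → Kˣ) b y = Finsupp.single x 1 := by
  obtain ⟨x₀, hx₀⟩ := Finsupp.ne_iff.1 hy
  rw [Finsupp.zero_apply] at hx₀
  have hdiff (z : X) : ∃ i, z ≠ x₀ → B.head (B.tail^[i] z) ≠ B.head (B.tail^[i] x₀) := by
    by_cases h : z = x₀
    · exact ⟨0, fun h' => absurd h h'⟩
    · by_contra! h'
      exact h (hsep _ _ fun i => (h' i).2)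
  choose d hd using hdiff
  obtain ⟨k, l, hkl⟩ := hconn x₀ x
  -- The first `n` edges tell `x₀` apart from the other paths in `y`; by the summand `k`, the `n`-th
  -- tail of `x₀` is also a tail of `x`.
  set n := (y.support.sup d + 1) + k with hn
  have hghost : B.rep K (1 : X → Kˣ) (B.ghostPrefix K x₀ n) y =
      Finsupp.single (B.tail^[n] x₀) (y x₀) := by
    conv_lhs => rw [← Finsupp.sum_single y, Finsupp.sum, map_sum]
    rw [Finset.sum_eq_single x₀]
    · rw [rep_ghostPrefix_single, if_pos fun _ _ => rfl]
    · intro z hz hne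
      have := Finset.le_sup (f := d) hz
      rw [rep_ghostPrefix_single, if_neg fun h => hd z hne (h _ (by omega))]
    · intro h
      rw [Finsupp.notMem_support_iff.1 h]
      simp
  have hn' : B.tail^[n] x₀ = B.tail^[(y.support.sup d + 1) + l] x := by
    rw [hn, Function.iterate_add_apply, hkl, ← Function.iterate_add_apply]
  refine ⟨(y x₀)⁻¹ • (B.edgePrefix K x ((y.support.sup d + 1) + l) * B.ghostPrefix K x₀ n), ?_⟩
  rw [map_smul, LinearMap.smul_apply, map_mul, Module.End.mul_apply, hghost, hn',
    rep_edgePrefix_single]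
  simp [hx₀]

end BranchingSystem

/-! ### The deformed representation at a periodic path -/

namespace BranchingSystem

open Classical LeavittPathAlgebra

variable (K : Type*) [Field K] {V E : Type*} {G : DirectedGraph V E} {X : Type*}
  (B : BranchingSystem G X)

open scoped DualNumber

/-- The weight equal to `1 + ε` at `x₀` and to `1` elsewhere. -/
noncomputable def epsWeight (x₀ x : X) : K[ε]ˣ :=
  if x = x₀ then
    { val := 1 + ε
      inv := 1 - ε
      val_inv := by linear_combination -(DualNumber.eps_mul_eps (R := K))
      inv_val := by linear_combination -(DualNumber.eps_mul_eps (R := K)) }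
  else 1

theorem epsWeight_self (x₀ : X) : (epsWeight K x₀ x₀ : K[ε]) = 1 + ε := by
  simp [epsWeight]

theorem epsWeight_of_ne {x₀ x : X} (h : x ≠ x₀) : (epsWeight K x₀ x : K[ε]) = 1 := by
  simp [epsWeight, h]

/-- The embedding `y ↦ ε y` of the unweighted representation into the weighted one. -/
noncomputable def epsMap : (X →₀ K) →ₗ[K] (X →₀ K[ε]) :=
  Finsupp.mapRange.linearMap (TrivSqZeroExt.inrHom K K)

theorem epsMap_single (x : X) : epsMap K (Finsupp.single x 1) = Finsupp.single x (ε : K[ε]) := by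
  rw [epsMap, Finsupp.mapRange.linearMap_apply, Finsupp.mapRange_single]
  rfl

theorem epsMap_injective : Function.Injective (epsMap K : (X →₀ K) →ₗ[K] (X →₀ K[ε])) :=
  Finsupp.mapRange_injective _ (map_zero _) TrivSqZeroExt.inr_injective

variable [Finite V]

theorem rep_epsMap (x₀ : X) (b : LeavittPathAlgebra K G) (y : X →₀ K) :
    B.rep K (epsWeight K x₀) b (epsMap K y) = epsMap K (B.rep K (1 : X → Kˣ) b y) := by
  refine B.rep_mapRange 1 (fun x a => ?_) b y
  by_cases h : x = x₀
  · subst h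
    rw [epsWeight_self]
    ext <;> simp
  · simp [epsWeight_of_ne K h]

variable {x₀ : X}

/-- The element `c - 1` of `L_K(G)`, where `c` is the path that a periodic `x₀` repeats. -/
noncomputable def cycleSubOne (x₀ : X) : LeavittPathAlgebra K G :=
  B.edgePrefix K x₀ (Function.minimalPeriod B.tail x₀) - 1

/-- No element of the unweighted representation is mapped by `c - 1` to one with a non-zero
coefficient at the periodic path. -/
theorem rep_cycleSubOne_apply (y : X →₀ K) :
    B.rep K (1 : X → Kˣ) (B.cycleSubOne K x₀) y x₀ = 0 := by
  rw [cycleSubOne, map_sub, LinearMap.sub_apply, Finsupp.sub_apply, rep_edgePrefix_apply,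
    Function.iterate_minimalPeriod]
  simp

/-- In the weighted representation `c - 1` maps `x₀` to `ε x₀`: a minimal period of `x₀` passes
through `x₀` exactly once, so it picks up the weight `1 + ε` exactly once. -/
theorem rep_cycleSubOne_single (hx₀ : x₀ ∈ Function.periodicPts B.tail) :
    B.rep K (epsWeight K x₀) (B.cycleSubOne K x₀) (Finsupp.single x₀ 1) =
      epsMap K (Finsupp.single x₀ 1) := by
  have hpos := Function.minimalPeriod_pos_of_mem_periodicPts hx₀
  have h := B.rep_edgePrefix_single K (epsWeight K x₀) x₀ (Function.minimalPeriod B.tail x₀) 1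
  rw [Function.iterate_minimalPeriod, Finset.prod_eq_single 0, Function.iterate_zero_apply,
    epsWeight_self] at h
  · rw [cycleSubOne, map_sub, map_one, LinearMap.sub_apply, h, Module.End.one_apply,
      epsMap_single, ← Finsupp.single_sub]
    simp
  · intro i hi hi0
    exact epsWeight_of_ne K fun h => hi0 <|
      Function.IsPeriodicPt.eq_zero_of_lt_minimalPeriod h (Finset.mem_range.1 hi)
  · intro h0
    exact absurd (Finset.mem_range.2 hpos) h0

/-- If `c - 1 = (c - 1) b (c - 1)`, then `c - 1` maps `b x₀` to `x₀` in the unweighted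
representation, which `rep_cycleSubOne_apply` excludes. -/
theorem not_isVonNeumannRegular (hx₀ : x₀ ∈ Function.periodicPts B.tail) :
    ¬ IsVonNeumannRegular (LeavittPathAlgebra K G) := by
  intro h
  obtain ⟨b, hb⟩ := h (B.cycleSubOne K x₀)
  have h₁ := B.rep_cycleSubOne_single K hx₀
  have h₂ := h₁
  rw [hb, map_mul, map_mul, Module.End.mul_apply, Module.End.mul_apply, h₁, rep_epsMap,
    rep_epsMap] at h₂
  have h₃ := B.rep_cycleSubOne_apply K (x₀ := x₀) (B.rep K 1 b (Finsupp.single x₀ 1))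
  rw [epsMap_injective K h₂, Finsupp.single_eq_same] at h₃
  exact one_ne_zero h₃

/-- If every simple module is injective, the simple module `S` given by the unweighted
representation is a direct summand of the weighted one, and a retraction of the latter onto `S`
yields an element of `S` which `c - 1` maps to `x₀`. The ring `R` may be `L_K(G)` itself or its
opposite. -/
theorem exists_isSimpleModule_not_injective {R : Type*} [Ring R]
    {φ : R →+* LeavittPathAlgebra K G} (hφ : Function.Surjective φ)
    (hsep : ∀ x z, (∀ i, B.head (B.tail^[i] x) = B.head (B.tail^[i] z)) → x = z)
    (hconn : ∀ x z, ∃ m n, B.tail^[m] x = B.tail^[n] z)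
    (hx₀ : x₀ ∈ Function.periodicPts B.tail) :
    ∃ _ : Module R (X →₀ K), IsSimpleModule R (X →₀ K) ∧ ¬ Module.Injective R (X →₀ K) := by
  let S : Module R (X →₀ K) :=
    Module.compHom (X →₀ K) ((B.rep K (1 : X → Kˣ)).toRingHom.comp φ)
  let M : Module R (X →₀ K[ε]) :=
    Module.compHom (X →₀ K[ε]) ((B.rep K (epsWeight K x₀)).toRingHom.comp φ)
  have smul_S (r : R) (y : X →₀ K) : r • y = B.rep K (1 : X → Kˣ) (φ r) y := rfl
  have smul_M (r : R) (y : X →₀ K[ε]) : r • y = B.rep K (epsWeight K x₀) (φ r) y := rfl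
  refine ⟨S, ?_, fun hinj => ?_⟩
  · have : Nontrivial (X →₀ K) := ⟨Finsupp.single x₀ 1, 0, by simp⟩
    rw [isSimpleModule_iff_toSpanSingleton_surjective]
    refine ⟨this, fun y hy z => ?_⟩
    have hmem : z ∈ (LinearMap.toSpanSingleton R (X →₀ K) y).range := by
      rw [← Finsupp.sum_single z]
      refine Submodule.sum_mem _ fun x _ => ?_
      obtain ⟨b, hb⟩ := B.exists_rep_eq_single hsep hconn hy x
      obtain ⟨r, hr⟩ := hφ (z x • b)
      refine ⟨r, ?_⟩
      rw [LinearMap.toSpanSingleton_apply, smul_S, hr, map_smul, LinearMap.smul_apply, hb,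
        Finsupp.smul_single_one]
    exact hmem
  · let ι : (X →₀ K) →ₗ[R] (X →₀ K[ε]) :=
      { toFun := epsMap K
        map_add' := map_add _
        map_smul' := fun r y => (B.rep_epsMap K x₀ (φ r) y).symm }
    obtain ⟨f, hf⟩ := hinj.out ι (epsMap_injective K) LinearMap.id
    obtain ⟨r, hr⟩ := hφ (B.cycleSubOne K x₀)
    have h₁ : r • (Finsupp.single x₀ 1 : X →₀ K[ε]) = ι (Finsupp.single x₀ 1) := by
      rw [smul_M, hr]
      exact B.rep_cycleSubOne_single K hx₀
    have h₂ : r • f (Finsupp.single x₀ 1) = Finsupp.single x₀ 1 := by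
      rw [← map_smul, h₁, hf, LinearMap.id_apply]
    have h₃ := B.rep_cycleSubOne_apply K (x₀ := x₀) (f (Finsupp.single x₀ 1))
    rw [← hr, ← smul_S, h₂, Finsupp.single_eq_same] at h₃
    exact one_ne_zero h₃

end BranchingSystem

/-! ### Infinite paths of graphs with a cycle -/

namespace DirectedGraph

variable {V E : Type*} (G : DirectedGraph V E)

/-- `G.Step w v` means that there is an edge from `v` to `w`. -/
def Step (w v : V) : Prop := ∃ e, G.s e = v ∧ G.r e = w

/-- A graph is acyclic in the sense that every vertex is accessible for the relation `Step`; for a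
finite graph this means that it has no cycle. -/
def IsAcyclic : Prop := WellFounded G.Step

/-- An infinite path is a sequence of edges each of which starts where the previous one ends. -/
def IsInfinitePath (p : ℕ → E) : Prop := ∀ i, G.r (p i) = G.s (p (i + 1))

/-- A finite graph that is not acyclic has a periodic infinite path: an infinite path visits some
vertex twice, and the part in between can be repeated. -/
theorem exists_periodic_of_not_isAcyclic [Finite V] (h : ¬ G.IsAcyclic) :
    ∃ p : ℕ → E, G.IsInfinitePath p ∧ ∃ n, 0 < n ∧ ∀ i, p (i + n) = p i := by
  rw [IsAcyclic, wellFounded_iff_isEmpty_descending_chain, not_isEmpty_iff] at h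
  obtain ⟨v, hv⟩ := h
  choose p hs hr using hv
  obtain ⟨i, j, hij, hvij⟩ : ∃ i j, i < j ∧ v i = v j := by
    obtain ⟨i, j, hne, h⟩ := Finite.exists_ne_map_eq_of_infinite v
    rcases lt_or_gt_of_ne hne with hlt | hlt
    exacts [⟨i, j, hlt, h⟩, ⟨j, i, hlt, h.symm⟩]
  obtain ⟨n, rfl⟩ : ∃ n, j = i + n := ⟨j - i, by omega⟩
  have hn : 0 < n := by omega
  -- Repeat the closed path formed by the edges `p i, …, p (i + n - 1)`.
  refine ⟨fun k => p (i + k % n), fun k => ?_, n, hn, fun k => by simp⟩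
  have hlt := Nat.mod_lt k hn
  rw [hr, hs, ← Nat.mod_add_mod, add_assoc]
  by_cases hk : k % n + 1 = n
  · rw [hk, Nat.mod_self, ← hvij, add_zero]
  · rw [Nat.mod_eq_of_lt (a := k % n + 1) (by omega)]

/-- The infinite paths having a common tail with `p`. -/
abbrev TailClass (p : ℕ → E) : Type _ :=
  {q : ℕ → E // G.IsInfinitePath q ∧ ∃ m n, ∀ i, q (m + i) = p (n + i)}

/-- The branching system of the infinite paths having a common tail with `p`, in an arbitrary larger
vertices and the edges. -/
def tailSystem (p : ℕ → E) : BranchingSystem G (ULift (G.TailClass p)) where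
  head x := x.down.1 0
  tail x := ⟨fun i => x.down.1 (i + 1), fun i => x.down.2.1 (i + 1), by
    obtain ⟨m, n, h⟩ := x.down.2.2
    refine ⟨m, n + 1, fun i => ?_⟩
    simpa only [add_assoc, add_comm 1 i] using h (i + 1)⟩
  cons e x he := ⟨fun i => Nat.casesOn i e x.down.1, fun i => by
    cases i with
    | zero => exact he
    | succ i => exact x.down.2.1 i, by
    obtain ⟨m, n, h⟩ := x.down.2.2
    refine ⟨m + 1, n, fun i => ?_⟩
    simpa only [add_right_comm] using h i⟩
  range_head x := x.down.2.1 0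
  head_cons _ _ _ := rfl
  tail_cons _ _ _ := rfl
  ext x y h h' := by
    refine ULift.ext _ _ (Subtype.ext (funext fun i => ?_))
    cases i with
    | zero => exact h
    | succ i => exact congrFun (congrArg (fun z => z.down.1) h') i

variable {G} {p : ℕ → E}

theorem tailSystem_iterate (x : ULift (G.TailClass p)) (n i : ℕ) :
    ((G.tailSystem p).tail^[n] x).down.1 i = x.down.1 (n + i) := by
  induction n generalizing i with
  | zero => simp
  | succ n ih =>
    rw [Function.iterate_succ_apply', add_right_comm, add_assoc]
    exact ih (i + 1)

theorem tailSystem_separates (x z : ULift (G.TailClass p))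
    (h : ∀ i, (G.tailSystem p).head ((G.tailSystem p).tail^[i] x) =
      (G.tailSystem p).head ((G.tailSystem p).tail^[i] z)) : x = z := by
  refine ULift.ext _ _ (Subtype.ext (funext fun i => ?_))
  have := h i
  change ((G.tailSystem p).tail^[i] x).down.1 0 = ((G.tailSystem p).tail^[i] z).down.1 0 at this
  rwa [tailSystem_iterate, tailSystem_iterate] at this

theorem tailSystem_connected (x z : ULift (G.TailClass p)) :
    ∃ m n, (G.tailSystem p).tail^[m] x = (G.tailSystem p).tail^[n] z := by
  obtain ⟨m, n, h⟩ := x.down.2.2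
  obtain ⟨m', n', h'⟩ := z.down.2.2
  refine ⟨m + n', m' + n, ULift.ext _ _ (Subtype.ext (funext fun i => ?_))⟩
  rw [tailSystem_iterate, tailSystem_iterate, add_assoc, h, add_assoc, h', ← add_assoc,
    ← add_assoc, add_comm n]

theorem tailSystem_periodic (hp : G.IsInfinitePath p) {n : ℕ} (hn : 0 < n)
    (h : ∀ i, p (i + n) = p i) :
    (⟨p, hp, 0, 0, fun _ => rfl⟩ : ULift (G.TailClass p)) ∈
      Function.periodicPts (G.tailSystem p).tail := by
  refine ⟨n, hn, ULift.ext _ _ (Subtype.ext (funext fun i => ?_))⟩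
  rw [tailSystem_iterate, add_comm]
  exact h i

end DirectedGraph

namespace LeavittPathAlgebra

variable {K : Type uK} [Field K] {V : Type uV} {E : Type uE} [Finite V] {G : DirectedGraph V E}

theorem isAcyclic_of_isVonNeumannRegular (h : IsVonNeumannRegular (LeavittPathAlgebra K G)) :
    G.IsAcyclic := by
  by_contra hG
  obtain ⟨p, hp, n, hn, hper⟩ := G.exists_periodic_of_not_isAcyclic hG
  exact (DirectedGraph.tailSystem.{_, _, 0} G p).not_isVonNeumannRegular K
    (DirectedGraph.tailSystem_periodic hp hn hper) h

/-- The ring `R` stands for `L_K(G)` or its opposite. -/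
theorem isAcyclic_of_simple_injective {R : Type*} [Ring R]
    {φ : R →+* LeavittPathAlgebra K G} (hφ : Function.Surjective φ)
    (h : ∀ (M : Type (max uK uV uE w)) [AddCommGroup M] [Module R M],
      IsSimpleModule R M → Module.Injective R M) : G.IsAcyclic := by
  by_contra hG
  obtain ⟨p, hp, n, hn, hper⟩ := G.exists_periodic_of_not_isAcyclic hG
  obtain ⟨_, hS, hS'⟩ := BranchingSystem.exists_isSimpleModule_not_injective K
    (X := ULift.{max uV uE w} (G.TailClass p)) (G.tailSystem p) hφ
    DirectedGraph.tailSystem_separates DirectedGraph.tailSystem_connected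
    (DirectedGraph.tailSystem_periodic hp hn hper)
  exact hS' (h _ hS)

end LeavittPathAlgebra

/-! ### Acyclic graphs -/

theorem IsSemisimpleRing.isVonNeumannRegular (R : Type*) [Ring R] [IsSemisimpleRing R] :
    IsVonNeumannRegular R := by
  intro a
  obtain ⟨J, hJ⟩ := exists_isCompl (Ideal.span {a})
  obtain ⟨x, hx, y, hy, hxy⟩ := Submodule.mem_sup.1
    (show (1 : R) ∈ Ideal.span {a} ⊔ J from hJ.sup_eq_top ▸ Submodule.mem_top)
  obtain ⟨b, rfl⟩ := Ideal.mem_span_singleton'.1 hx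
  refine ⟨b, ?_⟩
  -- Here `1 = b a + y` with `y ∈ J`, and `a y = a - a b a` lies both in `R a` and in `J`.
  have hay : a * y = 0 := by
    refine Submodule.disjoint_def.1 hJ.disjoint _ ?_ (J.mul_mem_left a hy)
    have : a * y = a - a * b * a := by
      rw [mul_assoc, ← mul_one_sub, ← hxy, add_sub_cancel_left]
    rw [this]
    exact sub_mem (Ideal.mem_span_singleton_self a)
      (Ideal.mem_span_singleton'.2 ⟨a * b, rfl⟩)
  rw [mul_assoc, ← add_zero (a * (b * a)), ← hay, ← mul_add, hxy, mul_one]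

/-- The sum of the semisimple left ideals of a ring. -/
def leftSocle (R : Type*) [Ring R] : Ideal R :=
  sSup {I : Ideal R | IsSemisimpleModule R I}

section Socle

variable {R : Type*} [Ring R]

theorem isSemisimpleModule_leftSocle : IsSemisimpleModule R (leftSocle R) := by
  rw [leftSocle, sSup_eq_iSup]
  exact isSemisimpleModule_biSup_of_isSemisimpleModule_submodule fun _ h => h

theorem mul_mem_leftSocle {a : R} (ha : a ∈ leftSocle R) (b : R) : a * b ∈ leftSocle R := by
  let f : R →ₗ[R] R := LinearMap.toSpanSingleton R R b
  have := isSemisimpleModule_leftSocle (R := R)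
  have h : IsSemisimpleModule R (Submodule.map f (leftSocle R)) :=
    IsSemisimpleModule.of_surjective (M := leftSocle R) (N := Submodule.map f (leftSocle R))
      (f.submoduleMap (leftSocle R)) (f.submoduleMap_surjective (leftSocle R))
  exact le_sSup (a := Submodule.map f (leftSocle R)) h ⟨a, ha, rfl⟩

/-- An element `a` lies in the socle if every non-zero element of the left ideal `R a` generates it,
so that `R a` is simple or zero. -/
theorem mem_leftSocle_of_forall {a : R} (h : ∀ b, b * a ≠ 0 → ∃ c, c * (b * a) = a) :
    a ∈ leftSocle R := by
  rcases eq_or_ne a 0 with rfl | ha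
  · exact zero_mem _
  have hs : IsSimpleModule R (Ideal.span {a}) := by
    rw [isSimpleModule_iff_isAtom]
    refine ⟨fun h => ha (Ideal.span_singleton_eq_bot.1 h), fun I hI => ?_⟩
    by_contra hne
    obtain ⟨x, hx, hx0⟩ := Submodule.ne_bot_iff I |>.1 hne
    obtain ⟨b, rfl⟩ := Ideal.mem_span_singleton'.1 (hI.le hx)
    obtain ⟨c, hc⟩ := h b hx0
    refine hI.not_ge ((Ideal.span_singleton_le_iff_mem I).2 ?_)
    rw [← hc]
    exact I.smul_mem c hx
  exact le_sSup (a := Ideal.span {a})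
    (show IsSemisimpleModule R (Ideal.span {a}) from inferInstance) (Ideal.mem_span_singleton_self a)

theorem isSemisimpleRing_of_one_mem_leftSocle (h : 1 ∈ leftSocle R) : IsSemisimpleRing R := by
  have htop := (Ideal.eq_top_iff_one _).2 h
  have := isSemisimpleModule_leftSocle (R := R)
  rw [htop] at this
  exact .congr (Submodule.topEquiv (R := R) (M := R)).symm

end Socle

namespace LeavittPathAlgebra

variable {K : Type uK} [Field K] {V : Type uV} {E : Type uE} [Finite V] {G : DirectedGraph V E}

/-- The left ideal generated by a sink `w` is spanned by the paths ending at `w`, because the ghost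
edges annihilate `w`. Hence only multiples of `w` survive left multiplication by a sink. -/
theorem vertex_mul_mul_vertex_of_sinks {v w : V} (hv : ∀ e, G.s e ≠ v) (hw : ∀ e, G.s e ≠ w)
    (a : LeavittPathAlgebra K G) :
    ∃ k : K, vertex K G v * (a * vertex K G w) = k • (vertex K G v * vertex K G w) := by
  let q (l : List E) : LeavittPathAlgebra K G := (l.map (edge K G)).prod * vertex K G w
  have q_nil : q [] = vertex K G w := by simp [q]
  have q_cons (e l) : q (e :: l) = edge K G e * q l := by simp [q, mul_assoc]
  let N : Submodule K (LeavittPathAlgebra K G) := Submodule.span K (Set.range q)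
  have hq (l) : q l ∈ N := Submodule.subset_span ⟨l, rfl⟩
  have key {b} (h : ∀ l, b * q l ∈ N) (y) (hy : y ∈ N) : b * y ∈ N := by
    induction hy using Submodule.span_induction with
    | mem _ hx => obtain ⟨l, rfl⟩ := hx; exact h l
    | zero => rw [mul_zero]; exact zero_mem _
    | add x y _ _ hx hy => rw [mul_add]; exact add_mem hx hy
    | smul k x _ hx => rw [mul_smul_comm]; exact N.smul_mem k hx
  have hvertex (u l) : vertex K G u * q l ∈ N := by
    rcases l with _ | ⟨e, l⟩
    · rw [q_nil]
      rcases eq_or_ne u w with rfl | h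
      · rw [vertex_mul_self, ← q_nil]; exact hq []
      · rw [vertex_mul_of_ne K G h]; exact zero_mem _
    · rw [q_cons, ← mul_assoc]
      rcases eq_or_ne u (G.s e) with rfl | h
      · rw [vertex_source_mul_edge, ← q_cons]; exact hq _
      · rw [vertex_mul_edge_of_ne K G h, zero_mul]; exact zero_mem _
  have hN (b y) (hy : y ∈ N) : b * y ∈ N := by
    induction b using gen_induction generalizing y with
    | vertex u => exact key (hvertex u) y hy
    | edge f => exact key (fun l => by rw [← q_cons]; exact hq _) y hy
    | ghost f =>
      refine key (fun l => ?_) y hy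
      rcases l with _ | ⟨e, l⟩
      · rw [q_nil, ghost_mul_vertex_of_ne K G (hw f)]; exact zero_mem _
      · rw [q_cons, ← mul_assoc]
        rcases eq_or_ne f e with rfl | h
        · rw [ghost_mul_edge_self]; exact hvertex _ l
        · rw [ghost_mul_edge_of_ne K G h, zero_mul]; exact zero_mem _
    | algebraMap k => rw [← Algebra.smul_def]; exact N.smul_mem k hy
    | add a b iha ihb => rw [add_mul]; exact add_mem (iha y hy) (ihb y hy)
    | mul a b iha ihb => rw [mul_assoc]; exact iha _ (ihb y hy)
  have ha : a * vertex K G w ∈ N := hN a _ (q_nil ▸ hq [])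
  generalize a * vertex K G w = y at ha
  induction ha using Submodule.span_induction with
  | mem _ hx =>
    obtain ⟨_ | ⟨e, l⟩, rfl⟩ := hx
    · exact ⟨1, by rw [q_nil, one_smul]⟩
    · exact ⟨0, by rw [q_cons, ← mul_assoc, vertex_mul_edge_of_ne K G (hv e).symm, zero_mul,
        zero_smul]⟩
  | zero => exact ⟨0, by simp⟩
  | add x y _ _ hx hy =>
    obtain ⟨k, hk⟩ := hx
    obtain ⟨l, hl⟩ := hy
    exact ⟨k + l, by rw [mul_add, hk, hl, add_smul]⟩
  | smul c x _ hx =>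
    obtain ⟨k, hk⟩ := hx
    exact ⟨c * k, by rw [mul_smul_comm, hk, mul_smul]⟩

variable [Finite E]

theorem exists_sink_mul_ne_zero_of_vertex_mul_ne_zero (hG : G.IsAcyclic) (v : V)
    {y : LeavittPathAlgebra K G} (hy : vertex K G v * y ≠ 0) :
    ∃ u, (∀ e, G.s e ≠ u) ∧ ∃ d, vertex K G u * (d * y) ≠ 0 := by
  induction v using hG.induction generalizing y with
  | _ v ih =>
    by_cases hv : ∀ e, G.s e ≠ v
    · exact ⟨v, hv, 1, by rwa [one_mul]⟩
    · push Not at hv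
      rw [vertex_eq_sum K G v (Set.toFinite _) hv, Finset.sum_mul] at hy
      obtain ⟨e, he, hne⟩ := Finset.exists_ne_zero_of_sum_ne_zero hy
      rw [Set.Finite.mem_toFinset] at he
      have hne' : vertex K G (G.r e) * (ghost K G e * y) ≠ 0 := by
        rw [← mul_assoc, vertex_range_mul_ghost]
        rw [mul_assoc] at hne
        exact right_ne_zero_of_mul hne
      obtain ⟨u, hu, d, hd⟩ := ih (G.r e) ⟨e, he, rfl⟩ hne'
      exact ⟨u, hu, d * ghost K G e, by rwa [mul_assoc]⟩

/-- Over a finite acyclic graph, every non-zero element can be moved to a sink: as long as a vertex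
is not a sink, the relation `v = ∑ e e^*` allows one to pass to the end of some edge. -/
theorem exists_sink_mul_ne_zero (hG : G.IsAcyclic) {y : LeavittPathAlgebra K G} (hy : y ≠ 0) :
    ∃ u, (∀ e, G.s e ≠ u) ∧ ∃ d, vertex K G u * (d * y) ≠ 0 := by
  have := Fintype.ofFinite V
  rw [← one_mul y, one_eq_finsum, finsum_eq_sum_of_fintype, Finset.sum_mul] at hy
  obtain ⟨v, -, hv⟩ := Finset.exists_ne_zero_of_sum_ne_zero hy
  exact exists_sink_mul_ne_zero_of_vertex_mul_ne_zero hG v hv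

/-- A sink generates a simple left ideal. -/
theorem sink_mem_leftSocle (hG : G.IsAcyclic) {w : V} (hw : ∀ e, G.s e ≠ w) :
    vertex K G w ∈ leftSocle (LeavittPathAlgebra K G) := by
  refine mem_leftSocle_of_forall fun b hb => ?_
  obtain ⟨u, hu, d, hd⟩ := exists_sink_mul_ne_zero hG hb
  obtain ⟨k, hk⟩ := vertex_mul_mul_vertex_of_sinks hu hw (d * b)
  rw [mul_assoc] at hk
  rw [hk] at hd
  rcases eq_or_ne u w with rfl | h
  · have hk0 : k ≠ 0 := left_ne_zero_of_smul hd
    refine ⟨k⁻¹ • (vertex K G u * d), ?_⟩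
    rw [smul_mul_assoc, mul_assoc, hk, vertex_mul_self, inv_smul_smul₀ hk0]
  · exact absurd (by rw [vertex_mul_of_ne K G h, smul_zero]) hd

theorem vertex_mem_leftSocle (hG : G.IsAcyclic) (v : V) :
    vertex K G v ∈ leftSocle (LeavittPathAlgebra K G) := by
  induction v using hG.induction with
  | _ v ih =>
    by_cases hv : ∀ e, G.s e ≠ v
    · exact sink_mem_leftSocle hG hv
    · push Not at hv
      rw [vertex_eq_sum K G v (Set.toFinite _) hv]
      refine Submodule.sum_mem _ fun e he => Ideal.mul_mem_left _ _ ?_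
      rw [Set.Finite.mem_toFinset] at he
      rw [← vertex_range_mul_ghost]
      exact mul_mem_leftSocle (ih _ ⟨e, he, rfl⟩) _

theorem isSemisimpleRing_of_isAcyclic (hG : G.IsAcyclic) :
    IsSemisimpleRing (LeavittPathAlgebra K G) := by
  have := Fintype.ofFinite V
  refine isSemisimpleRing_of_one_mem_leftSocle ?_
  rw [one_eq_finsum, finsum_eq_sum_of_fintype]
  exact Submodule.sum_mem _ fun v _ => vertex_mem_leftSocle hG v

end LeavittPathAlgebra

/-! ### The characterization -/

theorem mainTheorem2 (K : Type uK) [Field K] {V : Type uV} {E : Type uE}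
    [Finite V] [Finite E] (G : DirectedGraph V E) :
    ((∀ (M : Type (max uK uV uE w)) [AddCommGroup M] [Module (LeavittPathAlgebra K G) M],
        IsSimpleModule (LeavittPathAlgebra K G) M →
          Module.Injective (LeavittPathAlgebra K G) M) ↔
      IsVonNeumannRegular (LeavittPathAlgebra K G)) ∧
    ((∀ (M : Type (max uK uV uE w)) [AddCommGroup M] [Module (LeavittPathAlgebra K G)ᵐᵒᵖ M],
        IsSimpleModule (LeavittPathAlgebra K G)ᵐᵒᵖ M →
          Module.Injective (LeavittPathAlgebra K G)ᵐᵒᵖ M) ↔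
      IsVonNeumannRegular (LeavittPathAlgebra K G)) := by
  have regular (hG : G.IsAcyclic) : IsVonNeumannRegular (LeavittPathAlgebra K G) :=
    have := LeavittPathAlgebra.isSemisimpleRing_of_isAcyclic (K := K) hG
    IsSemisimpleRing.isVonNeumannRegular _
  have semisimple (h : IsVonNeumannRegular (LeavittPathAlgebra K G)) :
      IsSemisimpleRing (LeavittPathAlgebra K G) :=
    LeavittPathAlgebra.isSemisimpleRing_of_isAcyclic
      (LeavittPathAlgebra.isAcyclic_of_isVonNeumannRegular h)
  refine ⟨⟨fun h => regular ?_, fun h M _ _ _ => ?_⟩, ⟨fun h => regular ?_, fun h M _ _ _ => ?_⟩⟩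
  · exact LeavittPathAlgebra.isAcyclic_of_simple_injective.{uK, uV, uE, w}
      (φ := RingHom.id _) Function.surjective_id h
  · have := semisimple h
    exact Module.injective_of_isSemisimpleRing _ M
  · exact LeavittPathAlgebra.isAcyclic_of_simple_injective.{uK, uV, uE, w}
      (φ := (LeavittPathAlgebra.involution K G).toRingHom)
      (LeavittPathAlgebra.involution_surjective K G) h
  · have := semisimple h
    exact Module.injective_of_isSemisimpleRing _ M
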